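/- Let $p$ be an odd prime, $m,s\ge 1$ integers, $\mathbb F=\mathbb F_{p^m}$ and $\mathcal R=\mathbb F[u,v]/\langle u^2,v^2,uv-vu\rangle$. Let $\alpha=\alpha_1+\alpha_3v+\alpha_4uv\in\mathcal R$ with $\alpha_1,\alpha_3\in\mathbb F^*$, $\alpha_4\in\mathbb F$, and suppose that $\alpha$ is not a square in $\mathcal R$. Put $\mathcal R_\alpha=\mathcal R[x]/\langle x^{2p^s}-\alpha\rangle$ and $\alpha_0=\alpha_1^{p^{(q_0+1)m-s}}$, where $s=q_0m+r_0$ with $0\le r_0<m$ (so that $\alpha_0^{p^s}=\alpha_1$). Identify a word $(c_0,\dots,c_{2p^s-1})\in\mathcal R^{2p^s}$ with $c_0+c_1x+\dots+c_{2p^s-1}x^{2p^s-1}\in\mathcal R_\alpha$. The symbol-pair distance of two words $c,c'$ is $|\{i:(c_i,c_{i+1})\ne(c_i',c_{i+1}')\}|$, with indices modulo $2p^s$, and the symbol-pair distance $d_{sp}(\mathcal C)$ of a code $\mathcal C$ is the minimum of the symbol-pair distances of two distinct codewords. Let $0\le\ell\le 2p^s-1$, $0\le t<\ell$, let $z(x)\in\mathcal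 R_\alpha$ be $0$ or a unit, and let $\Im$ be the smallest non-negative integer with $u(x^2-\alpha_0)^{\Im}\in\langle (x^2-\alpha_0)^\ell+u(x^2-\alpha_0)^tz(x)\rangle$. Let $0\le\mu<\Im$ and let $\mathcal C$ be the (Type D) code given by the ideal $$\mathcal C=\langle (x^2-\alpha_0)^\ell+u(x^2-\alpha_0)^tz(x),\ u(x^2-\alpha_0)^\mu\rangle\subseteq\mathcal R_\alpha .$$ Then $$d_{sp}(\mathcal C)=\begin{cases}2 & \text{if } 0\le\mu\le p^s,\\ 2(\Gamma+1)p^\gamma & \text{if } 2p^s-p^{s-\gamma}+(\Gamma-1)p^{s-\gamma-1}+1\le\mu\le 2p^s-p^{s-\gamma}+\Gamma p^{s-\gamma-1},\end{cases}$$ where in the second case $\Gamma,\gamma$ are integers with $1\le\Gamma\le p-1$ and $0\le\gamma\le s-1$. -/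

import Mathlib

open Polynomial

noncomputable section

namespace PairCode

/-- The finite commutative ring `𝓡 = F[u, v] / ⟨u², v², uv - vu⟩`; the variable `X 0` is `u` and
`X 1` is `v`. -/
abbrev BaseRing (F : Type*) [Field F] : Type _ :=
  MvPolynomial (Fin 2) F ⧸
    (Ideal.span {MvPolynomial.X 0 ^ 2, MvPolynomial.X 1 ^ 2,
      MvPolynomial.X 0 * MvPolynomial.X 1 - MvPolynomial.X 1 * MvPolynomial.X 0} :
        Ideal (MvPolynomial (Fin 2) F))

/-- The class of the variable `u` in `𝓡`. -/
def u (F : Type*) [Field F] : BaseRing F := Ideal.Quotient.mk _ (MvPolynomial.X 0)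

/-- The class of the variable `v` in `𝓡`. -/
def v (F : Type*) [Field F] : BaseRing F := Ideal.Quotient.mk _ (MvPolynomial.X 1)

/-- The element `α₁ + α₃ v + α₄ uv` of `𝓡`. -/
def alpha {F : Type*} [Field F] (a₁ a₃ a₄ : F) : BaseRing F :=
  algebraMap F (BaseRing F) a₁ + algebraMap F (BaseRing F) a₃ * v F
    + algebraMap F (BaseRing F) a₄ * (u F * v F)

/-- The element `α₀ = α₁ ^ (p ^ ((q₀ + 1) m - s))`, where `s = q₀ m + r₀` with `0 ≤ r₀ < m`.
It is the `p ^ s`-th root of `α₁` in the field with `p ^ m` elements. -/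
def alphaZero {F : Type*} [Field F] (p m s : ℕ) (a₁ : F) : F :=
  a₁ ^ p ^ ((s / m + 1) * m - s)

/-- The ring `A[x] / ⟨xⁿ - α⟩`, whose ideals are the `α`-constacyclic codes of length `n`
over `A`. -/
abbrev ConstaRing {A : Type*} [CommRing A] (n : ℕ) (α : A) : Type _ :=
  AdjoinRoot (X ^ n - C α : A[X])

/-- The polynomial representation `c₀ + c₁ x + ⋯ + c_{n-1} x^{n-1}` of a word, as an element of
`A[x] / ⟨xⁿ - α⟩`. -/
def wordPoly {A : Type*} [CommRing A] (n : ℕ) (α : A) (c : Fin n → A) : ConstaRing n α :=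
  AdjoinRoot.mk (X ^ n - C α) (∑ i : Fin n, C (c i) * X ^ (i : ℕ))

/-- The code in `Aⁿ` consisting of the words whose polynomial representation lies in the given
ideal. -/
def codeOf {A : Type*} [CommRing A] {n : ℕ} {α : A} (I : Ideal (ConstaRing n α)) :
    Set (Fin n → A) :=
  {c | wordPoly n α c ∈ I}

/-- The symbol-pair distance of two words; indices are read cyclically modulo `n`. -/
def pairDist {A : Type*} {n : ℕ} [NeZero n] (x y : Fin n → A) : ℕ :=
  Set.ncard {i : Fin n | (x i, x (i + 1)) ≠ (y i, y (i + 1))}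

/-- The symbol-pair distance of a code: the least symbol-pair distance of two distinct codewords
(and `0` for a code with at most one word). -/
def codePairDist {A : Type*} {n : ℕ} [NeZero n] (S : Set (Fin n → A)) : ℕ :=
  sInf {d : ℕ | ∃ x ∈ S, ∃ y ∈ S, x ≠ y ∧ pairDist x y = d}

section Codes

variable {F : Type*} [Field F]

/-- The element `u` of `𝓡[x] / ⟨xⁿ - α⟩`. -/
def uElt (n : ℕ) (α : BaseRing F) : ConstaRing n α :=
  AdjoinRoot.of (X ^ n - C α) (u F)

/-- The element `x² - α₀` of `𝓡[x] / ⟨xⁿ - α⟩`. -/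
def wElt (n : ℕ) (α : BaseRing F) (a₀ : F) : ConstaRing n α :=
  AdjoinRoot.mk (X ^ n - C α) (X ^ 2 - C (algebraMap F (BaseRing F) a₀))

/-- The generator `(x² - α₀)^ℓ + u (x² - α₀)^t z(x)`. -/
def genElt (n : ℕ) (α : BaseRing F) (a₀ : F) (l t : ℕ) (z : ConstaRing n α) : ConstaRing n α :=
  wElt n α a₀ ^ l + uElt n α * wElt n α a₀ ^ t * z

/-- The smallest `k` such that `u (x² - α₀)^k` lies in `⟨(x² - α₀)^ℓ + u (x² - α₀)^t z(x)⟩`. The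
set is never empty: it contains `ℓ`, because `u² = 0`. -/
def torsionIndex (n : ℕ) (α : BaseRing F) (a₀ : F) (l t : ℕ) (z : ConstaRing n α) : ℕ :=
  sInf {k : ℕ | uElt n α * wElt n α a₀ ^ k ∈ Ideal.span {genElt n α a₀ l t z}}

/-- The ideal `⟨(x² - α₀)^ℓ + u (x² - α₀)^t z(x), u (x² - α₀)^μ⟩`. -/
def typeDIdeal (n : ℕ) (α : BaseRing F) (a₀ : F) (l t μ : ℕ) (z : ConstaRing n α) :
    Ideal (ConstaRing n α) :=
  Ideal.span {genElt n α a₀ l t z, uElt n α * wElt n α a₀ ^ μ}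

end Codes

end PairCode

end

namespace PairCode

section Sections

variable {F : Type*} [Field F]

/-- The `r`-th section of `f` modulo `q`: its `n`-th coefficient is that of `X ^ (n q + r)`
in `f`. -/
noncomputable def polySection (q r : ℕ) (f : F[X]) : F[X] := contract q (divX^[r] f)

theorem coeff_iterate_divX (r : ℕ) (f : F[X]) (n : ℕ) : (divX^[r] f).coeff n = f.coeff (n + r) := by
  induction r generalizing f with
  | zero => simp
  | succ r ih => rw [Function.iterate_succ_apply, ih, coeff_divX]; rfl

theorem coeff_polySection {q : ℕ} (hq : q ≠ 0) (r : ℕ) (f : F[X]) (n : ℕ) :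
    (polySection q r f).coeff n = f.coeff (n * q + r) := by
  rw [polySection, coeff_contract hq, coeff_iterate_divX]

theorem polySection_add {q : ℕ} (hq : q ≠ 0) (r : ℕ) (f g : F[X]) :
    polySection q r (f + g) = polySection q r f + polySection q r g := by
  ext n; simp [coeff_polySection hq]

theorem polySection_expand_mul {q r : ℕ} (hr : r < q) (h g : F[X]) :
    polySection q r (expand F q h * g) = h * polySection q r g := by
  have hq : q ≠ 0 := by omega
  induction h using Polynomial.induction_on' with
  | add a b ha hb => rw [map_add, add_mul, polySection_add hq, ha, hb, add_mul]
  | monomial k c =>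
    ext n
    rw [coeff_polySection hq, expand_monomial, ← C_mul_X_pow_eq_monomial,
      ← C_mul_X_pow_eq_monomial, mul_assoc, mul_assoc, coeff_C_mul, coeff_C_mul, coeff_X_pow_mul',
      coeff_X_pow_mul', coeff_polySection hq]
    by_cases hk : k ≤ n
    · have h1 : q * k ≤ n * q + r := by nlinarith
      have h2 : n * q + r - k * q = (n - k) * q + r := by
        rw [Nat.sub_mul]; have := Nat.mul_le_mul_right q hk; omega
      simp only [mul_comm k q] at *
      simp [hk, h1, h2]
    · have h1 : ¬ q * k ≤ n * q + r := by
        have : (n + 1) * q ≤ k * q := Nat.mul_le_mul_right q (by omega)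
        nlinarith
      simp only [mul_comm k q] at *
      simp [hk, h1]

theorem sum_card_support_polySection_le {q : ℕ} (f : F[X]) (T : Finset ℕ) (hT : ∀ r ∈ T, r < q) :
    ∑ r ∈ T, (polySection q r f).support.card ≤ f.support.card := by
  classical
  rw [← Finset.card_sigma]
  apply Finset.card_le_card_of_injOn (fun x => x.2 * q + x.1)
  · rintro ⟨r, n⟩ hx
    simp only [Finset.coe_sigma, Set.mem_sigma_iff, Finset.mem_coe, mem_support_iff] at hx
    have := hT r hx.1
    rw [coeff_polySection (by omega)] at hx
    simpa using hx.2
  · rintro ⟨r, n⟩ hx ⟨r', n'⟩ hx' h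
    simp only [Finset.coe_sigma, Set.mem_sigma_iff, Finset.mem_coe] at hx hx' h
    have h1 := hT r hx.1
    have h2 := hT r' hx'.1
    have e1 : r = r' := by
      have := congrArg (· % q) h
      simpa [Nat.mul_add_mod', Nat.mod_eq_of_lt h1, Nat.mod_eq_of_lt h2] using this
    subst e1
    have : n = n' := Nat.eq_of_mul_eq_mul_right (show 0 < q by omega) (by omega)
    subst this; rfl

theorem degree_polySection_lt {q r d : ℕ} (hq : q ≠ 0) {f : F[X]} (hf : f.degree < ((d * q : ℕ) : WithBot ℕ)) :
    (polySection q r f).degree < d := by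
  rw [degree_lt_iff_coeff_zero] at hf ⊢
  intro n hn
  rw [coeff_polySection hq]
  exact hf _ (by have := Nat.mul_le_mul_right q hn; omega)

end Sections

section Weights

variable {F : Type*} [Field F] {p : ℕ} [CharP F p]

/-- A nonzero polynomial of degree less than the characteristic with a nonzero root of
multiplicity `k` has at least `k + 1` terms. -/
theorem lt_card_support_of_pow_dvd {a : F} (ha : a ≠ 0) (k : ℕ) (h : F[X]) (h0 : h ≠ 0)
    (hdeg : h.degree < p) (hd : (X - C a) ^ k ∣ h) : k < h.support.card := by
  induction k generalizing h with
  | zero => exact Finset.card_pos.mpr (by simpa using h0)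
  | succ k ih =>
    set m := h.natTrailingDegree with hm
    set g : F[X] := X * derivative h - C (m : F) * h with hg
    have hcoef (n : ℕ) : g.coeff n = ((n : F) - m) * h.coeff n := by
      rw [hg, coeff_sub, coeff_C_mul]
      cases n with
      | zero => simp
      | succ n => rw [coeff_X_mul, coeff_derivative]; push_cast; ring
    have hlt {n : ℕ} (hn : h.coeff n ≠ 0) : n < p := by
      by_contra hc
      exact hn ((degree_lt_iff_coeff_zero _ _).mp hdeg n (not_lt.mp hc))
    have hmc : h.coeff m ≠ 0 := trailingCoeff_nonzero_iff_nonzero.mpr h0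
    have hsupp : g.support = h.support.erase m := by
      ext n
      rw [Finset.mem_erase, mem_support_iff, mem_support_iff, hcoef, Ne, mul_eq_zero, not_or]
      refine and_congr_left fun hn => not_congr ?_
      rw [sub_eq_zero, CharP.natCast_eq_natCast F p, Nat.ModEq, Nat.mod_eq_of_lt (hlt hn),
        Nat.mod_eq_of_lt (hlt hmc)]
    have hdvd : (X - C a) ^ k ∣ g := by
      obtain ⟨e, rfl⟩ := hd
      refine dvd_sub (Dvd.dvd.mul_left ?_ _) (Dvd.dvd.mul_left ?_ _)
      · rw [derivative_mul]
        refine dvd_add (Dvd.dvd.mul_right ?_ _) (Dvd.dvd.mul_right (pow_dvd_pow _ k.le_succ) _)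
        rw [derivative_X_sub_C_pow]
        exact Dvd.dvd.mul_left (by simp) _
      · exact Dvd.dvd.mul_right (pow_dvd_pow _ k.le_succ) _
    have hcard : g.support.card = h.support.card - 1 := by
      rw [hsupp, Finset.card_erase_of_mem (mem_support_iff.mpr hmc)]
    have hg0 : g ≠ 0 := by
      intro hz
      have hs1 : h.support.card ≤ 1 := by
        rw [hz] at hcard; simp at hcard; omega
      have hmono : h = monomial m (h.coeff m) := by
        ext n
        rw [coeff_monomial]
        split_ifs with hmn
        · rw [hmn]
        · by_contra hn
          exact hmn (Finset.card_le_one.mp hs1 _ (mem_support_iff.mpr hmc) _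
            (mem_support_iff.mpr hn))
      have hroot : h.eval a = 0 := by
        rw [← IsRoot, ← dvd_iff_isRoot]
        exact (dvd_pow_self _ k.succ_ne_zero).trans hd
      rw [hmono, eval_monomial] at hroot
      exact (mul_ne_zero hmc (pow_ne_zero _ ha)) hroot
    have hgdeg : g.degree < p := by
      rw [degree_lt_iff_coeff_zero] at hdeg ⊢
      intro n hn
      rw [hcoef, hdeg n hn, mul_zero]
    have := ih g hg0 hgdeg hdvd
    omega

variable [hp : Fact p.Prime]

theorem X_sub_C_pow_char_pow_mul (a : F) (e k : ℕ) :
    (X - C a) ^ (p ^ e * k) = expand F (p ^ e) ((X - C (a ^ p ^ e)) ^ k) := by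
  rw [pow_mul, sub_pow_char_pow, map_pow, map_sub, expand_X, expand_C, C_pow]

theorem exists_polySection_ne_zero {q : ℕ} (hq : 0 < q) {f : F[X]} (hf : f ≠ 0) :
    ∃ r < q, polySection q r f ≠ 0 := by
  obtain ⟨n, hn⟩ : ∃ n, f.coeff n ≠ 0 := by
    by_contra! h
    exact hf (ext fun n => by simp [h])
  refine ⟨n % q, Nat.mod_lt _ hq, fun h => hn ?_⟩
  have := coeff_polySection hq.ne' (n % q) f (n / q)
  rw [h, coeff_zero, Nat.div_add_mod'] at this
  exact this.symm

/-- A nonzero polynomial of degree less than `p ^ (e + 1)` in which `a ≠ 0` has multiplicity more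
than `k p ^ e` has at least `k + 2` terms. -/
theorem add_two_le_card_support {a : F} (ha : a ≠ 0) (e k : ℕ) (f : F[X]) (hf : f ≠ 0)
    (hdeg : f.degree < ((p ^ (e + 1) : ℕ) : WithBot ℕ)) (hd : (X - C a) ^ (p ^ e * k + 1) ∣ f) :
    k + 2 ≤ f.support.card := by
  have hq : 0 < p ^ e := pow_pos hp.out.pos e
  set b := a ^ p ^ e with hb
  have hb0 : b ≠ 0 := pow_ne_zero _ ha
  have hsdeg (r : ℕ) : (polySection (p ^ e) r f).degree < p :=
    degree_polySection_lt hq.ne' (by rwa [pow_succ, mul_comm] at hdeg)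
  obtain ⟨r, hr, hfr⟩ := exists_polySection_ne_zero hq hf
  have hsec (r : ℕ) (hr : r < p ^ e) : (X - C b) ^ k ∣ polySection (p ^ e) r f := by
    obtain ⟨g, rfl⟩ := (pow_dvd_pow _ (Nat.le_succ _)).trans hd
    rw [X_sub_C_pow_char_pow_mul, polySection_expand_mul hr]
    exact dvd_mul_right _ _
  by_cases h2 : ∃ r' < p ^ e, r' ≠ r ∧ polySection (p ^ e) r' f ≠ 0
  · obtain ⟨r', hr', hne, hfr'⟩ := h2
    have h := sum_card_support_polySection_le (q := p ^ e) f {r', r} (by simp [hr, hr'])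
    rw [Finset.sum_pair hne] at h
    have := lt_card_support_of_pow_dvd hb0 k _ hfr (hsdeg r) (hsec r hr)
    have := lt_card_support_of_pow_dvd hb0 k _ hfr' (hsdeg r') (hsec r' hr')
    omega
  · push Not at h2
    have hfeq : f = X ^ r * expand F (p ^ e) (polySection (p ^ e) r f) := by
      ext n
      rw [coeff_X_pow_mul', coeff_expand hq]
      by_cases hn : n % p ^ e = r
      · have hnr : n - r = n / p ^ e * p ^ e := by
          have := Nat.div_add_mod' n (p ^ e); omega
        have hle : r ≤ n := hn ▸ Nat.mod_le _ _
        rw [if_pos hle, hnr, if_pos (dvd_mul_left _ _), Nat.mul_div_cancel _ hq,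
          coeff_polySection hq.ne']
        congr 1; omega
      · have h0 := congrArg (fun g : F[X] => g.coeff (n / p ^ e)) (h2 _ (Nat.mod_lt n hq) hn)
        simp only [coeff_polySection hq.ne', coeff_zero, Nat.div_add_mod'] at h0
        rw [h0]
        split_ifs with h1 h3
        · exfalso
          obtain ⟨c, hc⟩ := h3
          apply hn
          rw [show n = p ^ e * c + r by omega, Nat.mul_add_mod, Nat.mod_eq_of_lt hr]
        · rfl
        · rfl
    have hdh : (X - C b) ^ (k + 1) ∣ polySection (p ^ e) r f := by
      obtain ⟨g, hg⟩ := hsec r hr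
      have hdg : X - C a ∣ X ^ r * expand F (p ^ e) g := by
        rw [hfeq, hg, map_mul, ← X_sub_C_pow_char_pow_mul, pow_succ, mul_left_comm] at hd
        exact (mul_dvd_mul_iff_left (pow_ne_zero _ (X_sub_C_ne_zero a))).mp hd
      rw [dvd_iff_isRoot, IsRoot, eval_mul, eval_pow, eval_X, expand_eval] at hdg
      have hgr : g.eval b = 0 := (mul_eq_zero.mp hdg).resolve_left (pow_ne_zero _ ha)
      rw [hg, pow_succ]
      exact mul_dvd_mul_left _ (dvd_iff_isRoot.mpr hgr)
    have h1 := lt_card_support_of_pow_dvd hb0 (k + 1) _ hfr (hsdeg r) hdh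
    have h2 := sum_card_support_polySection_le (q := p ^ e) f {r} (by simp [hr])
    rw [Finset.sum_singleton] at h2
    omega

/-- Factoring out `(X - a) ^ ((p - 1) p ^ e)` from a polynomial of degree less than `p ^ (e + 1)`
divides the number of terms by at least `p`. -/
theorem char_mul_card_support_le {a : F} (ha : a ≠ 0) (e : ℕ) (g : F[X])
    (hdeg : ((X - C a) ^ (p ^ e * (p - 1)) * g).degree < ((p ^ (e + 1) : ℕ) : WithBot ℕ)) :
    p * g.support.card ≤ ((X - C a) ^ (p ^ e * (p - 1)) * g).support.card := by
  have hq : 0 < p ^ e := pow_pos hp.out.pos e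
  have hp1 : 1 < p := hp.out.one_lt
  rcases eq_or_ne g 0 with rfl | hg0
  · simp
  have hgdeg : g.natDegree < p ^ e := by
    have hm := (monic_X_sub_C a).pow (p ^ e * (p - 1))
    rw [← natDegree_lt_iff_degree_lt (mul_ne_zero hm.ne_zero hg0),
      hm.natDegree_mul' hg0, natDegree_pow, natDegree_X_sub_C] at hdeg
    have : p ^ (e + 1) = p ^ e * (p - 1) + p ^ e := by
      rw [pow_succ, ← Nat.mul_succ]; congr 1; omega
    omega
  have hsupp (r : ℕ) (hr : r ∈ g.support) : r < p ^ e :=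
    (le_natDegree_of_mem_supp r hr).trans_lt hgdeg
  refine le_trans ?_ (sum_card_support_polySection_le (q := p ^ e) _ g.support hsupp)
  rw [mul_comm, ← smul_eq_mul]
  refine Finset.card_nsmul_le_sum _ _ _ fun r hr => ?_
  have hsec := polySection_expand_mul (hsupp r hr) ((X - C (a ^ p ^ e)) ^ (p - 1)) g
  rw [← X_sub_C_pow_char_pow_mul] at hsec
  have hne : polySection (p ^ e) r g ≠ 0 := fun h0 => by
    have := coeff_polySection hq.ne' r g 0
    rw [h0, coeff_zero, zero_mul, zero_add] at this
    exact mem_support_iff.mp hr this.symm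
  have := lt_card_support_of_pow_dvd (pow_ne_zero (p ^ e) ha) (p - 1)
    (polySection (p ^ e) r ((X - C a) ^ (p ^ e * (p - 1)) * g))
    (by rw [hsec]; exact mul_ne_zero (pow_ne_zero _ (X_sub_C_ne_zero _)) hne)
    (degree_polySection_lt hq.ne' (by rwa [mul_comm p, ← pow_succ]))
    (by rw [hsec]; exact dvd_mul_right _ _)
  omega

/-- The lower bound for the Hamming weight of the words of a repeated-root constacyclic code of
length `p ^ (e + g + 1)`. -/
theorem mul_pow_le_card_support {a : F} (ha : a ≠ 0) (e k g : ℕ) (f : F[X]) (hf : f ≠ 0)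
    (hdeg : f.degree < ((p ^ (e + g + 1) : ℕ) : WithBot ℕ))
    (hd : (X - C a) ^ (p ^ (e + g + 1) - p ^ (e + 1) + p ^ e * k + 1) ∣ f) :
    (k + 2) * p ^ g ≤ f.support.card := by
  have hp1 : 1 < p := hp.out.one_lt
  induction g generalizing f with
  | zero =>
    simpa using add_two_le_card_support ha e k f hf hdeg (by simpa using hd)
  | succ g ih =>
    have hle : p ^ (e + 1) ≤ p ^ (e + g + 1) := Nat.pow_le_pow_right hp1.le (by omega)
    have hsplit : p ^ (e + (g + 1) + 1) = p ^ (e + g + 1) * (p - 1) + p ^ (e + g + 1) := by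
      rw [← Nat.mul_succ, show (p - 1).succ = p by omega, ← pow_succ]; rfl
    obtain ⟨c, rfl⟩ := (pow_dvd_pow (X - C a)
      (show p ^ (e + g + 1) * (p - 1) ≤ _ by rw [hsplit]; omega)).trans hd
    have hexp : p ^ (e + (g + 1) + 1) - p ^ (e + 1) + p ^ e * k + 1 =
        p ^ (e + g + 1) * (p - 1) + (p ^ (e + g + 1) - p ^ (e + 1) + p ^ e * k + 1) := by omega
    rw [hexp, pow_add] at hd
    have hd' := (mul_dvd_mul_iff_left (pow_ne_zero _ (X_sub_C_ne_zero a))).mp hd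
    have hc0 : c ≠ 0 := right_ne_zero_of_mul hf
    have hcard := char_mul_card_support_le ha (e + g + 1) c (by simpa [add_assoc] using hdeg)
    have hcdeg : c.degree < ((p ^ (e + g + 1) : ℕ) : WithBot ℕ) := by
      have hm := (monic_X_sub_C a).pow (p ^ (e + g + 1) * (p - 1))
      rw [← natDegree_lt_iff_degree_lt hf, hm.natDegree_mul' hc0, natDegree_pow,
        natDegree_X_sub_C] at hdeg
      rw [← natDegree_lt_iff_degree_lt hc0]
      omega
    have := ih c hc0 hcdeg hd'
    calc (k + 2) * p ^ (g + 1) = p * ((k + 2) * p ^ g) := by ring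
      _ ≤ p * c.support.card := Nat.mul_le_mul_left _ this
      _ ≤ _ := hcard

theorem card_support_expand_le (q : ℕ) (f : F[X]) :
    (expand F q f).support.card ≤ f.support.card := by
  classical
  rw [expand_eq_sum]
  refine (Finset.card_le_card (?_ : _ ⊆ f.support.image (· * q))).trans Finset.card_image_le
  intro n hn
  rw [mem_support_iff, Polynomial.sum, finsetSum_coeff] at hn
  obtain ⟨i, hi, hne⟩ := Finset.exists_ne_zero_of_sum_ne_zero hn
  rw [← pow_mul, coeff_C_mul, coeff_X_pow] at hne
  refine Finset.mem_image.mpr ⟨i, hi, ?_⟩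
  by_contra h
  exact hne (by rw [if_neg (by rw [mul_comm]; exact fun h' => h h'.symm), mul_zero])

theorem card_support_X_sub_C_pow_le (a : F) (k : ℕ) : ((X - C a) ^ k).support.card ≤ k + 1 := by
  have := card_supp_le_succ_natDegree ((X - C a) ^ k)
  rwa [natDegree_pow, natDegree_X_sub_C, mul_one] at this

/-- The power of `X - a` that attains the bound of `mul_pow_le_card_support`. -/
theorem card_support_X_sub_C_pow_le_mul (a : F) (e k g : ℕ) :
    ((X - C a) ^ (p ^ (e + g + 1) - p ^ (e + 1) + p ^ e * k)).support.card ≤ (k + 1) * p ^ g := by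
  have hp1 : 1 < p := hp.out.one_lt
  have h1 : p ^ (e + g + 1) - p ^ (e + 1) = p ^ (e + 1) * (p ^ g - 1) := by
    rw [Nat.mul_sub, ← pow_add, mul_one]; congr 2; omega
  rw [h1, pow_add, X_sub_C_pow_char_pow_mul, X_sub_C_pow_char_pow_mul, mul_comm (k + 1)]
  refine card_support_mul_le.trans (Nat.mul_le_mul ?_ ?_)
  · refine (card_support_expand_le _ _).trans ((card_support_X_sub_C_pow_le _ _).trans ?_)
    have := Nat.pow_pos (n := g) hp.out.pos
    omega
  · exact (card_support_expand_le _ _).trans (card_support_X_sub_C_pow_le _ _)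

end Weights

section PairDistance

variable {A : Type*}

/-- The pair distance is at most twice the Hamming distance. -/
theorem pairDist_le_two_mul {n : ℕ} [NeZero n] (x y : Fin n → A) (T : Finset (Fin n))
    (hT : ∀ i, x i ≠ y i → i ∈ T) : pairDist x y ≤ 2 * T.card := by
  classical
  have hsub : {i : Fin n | (x i, x (i + 1)) ≠ (y i, y (i + 1))} ⊆
      (T ∪ T.image (· - 1) : Finset (Fin n)) := by
    intro i hi
    rw [Finset.mem_coe, Finset.mem_union, Finset.mem_image]
    by_cases h : x i = y i
    · refine Or.inr ⟨i + 1, hT _ fun h' => hi ?_, by simp⟩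
      rw [h, h']
    · exact Or.inl (hT i h)
  calc pairDist x y ≤ (T ∪ T.image (· - 1) : Finset (Fin n)).card := by
        rw [← Set.ncard_coe_finset]; exact Set.ncard_le_ncard hsub
    _ ≤ T.card + (T.image (· - 1)).card := Finset.card_union_le _ _
    _ ≤ 2 * T.card := by have := Finset.card_image_le (s := T) (f := (· - 1)); omega

/-- Differences at positions of one parity count twice in the pair distance. -/
theorem two_mul_le_pairDist {N : ℕ} [NeZero (2 * N)] (x y : Fin (2 * N) → A)
    (T : Finset (Fin (2 * N))) (ε : ℕ) (hpar : ∀ i ∈ T, (i : ℕ) % 2 = ε)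
    (hT : ∀ i ∈ T, x i ≠ y i) : 2 * T.card ≤ pairDist x y := by
  classical
  have hN : 0 < 2 * N := Nat.pos_of_ne_zero (NeZero.ne _)
  have hsub : ((T ∪ T.image (· - 1) : Finset (Fin (2 * N))) : Set (Fin (2 * N))) ⊆
      {i | (x i, x (i + 1)) ≠ (y i, y (i + 1))} := by
    intro i hi
    rw [Finset.mem_coe, Finset.mem_union, Finset.mem_image] at hi
    rw [Set.mem_ofPred_eq, Ne, Prod.mk.injEq, not_and_or]
    rcases hi with hi | ⟨k, hk, rfl⟩
    · exact Or.inl (hT i hi)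
    · refine Or.inr ?_
      rw [sub_add_cancel]
      exact hT k hk
  have hdisj : Disjoint T (T.image (· - 1)) := by
    rw [Finset.disjoint_left]
    intro i hi hi'
    obtain ⟨k, hk, hki⟩ := Finset.mem_image.mp hi'
    have hk1 : k = i + 1 := by rw [← hki, sub_add_cancel]
    have h1 := hpar i hi
    have h2 := hpar k hk
    rw [hk1, Fin.val_add, Fin.val_one', Nat.mod_mod_of_dvd _ (dvd_mul_right 2 N), Nat.add_mod,
      Nat.mod_mod_of_dvd _ (dvd_mul_right 2 N)] at h2
    omega
  rw [pairDist]
  refine le_trans ?_ (Set.ncard_le_ncard hsub)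
  rw [Set.ncard_coe_finset, Finset.card_union_of_disjoint hdisj,
    Finset.card_image_of_injective _ (sub_left_injective), two_mul]

theorem codePairDist_eq {n : ℕ} [NeZero n] {S : Set (Fin n → A)} {d : ℕ}
    (hle : ∃ x ∈ S, ∃ y ∈ S, x ≠ y ∧ pairDist x y ≤ d)
    (hge : ∀ x ∈ S, ∀ y ∈ S, x ≠ y → d ≤ pairDist x y) : codePairDist S = d := by
  obtain ⟨x, hx, y, hy, hxy, h⟩ := hle
  have hmem : pairDist x y ∈ {d | ∃ x ∈ S, ∃ y ∈ S, x ≠ y ∧ pairDist x y = d} :=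
    ⟨x, hx, y, hy, hxy, rfl⟩
  refine le_antisymm ((Nat.sInf_le hmem).trans h) ?_
  refine le_csInf ⟨_, hmem⟩ ?_
  rintro _ ⟨x, hx, y, hy, hxy, rfl⟩
  exact hge x hx y hy hxy

end PairDistance

section BaseRingLemmas

variable {F : Type*} [Field F]

theorem u_mul_u : u F * u F = 0 := by
  rw [u, ← map_mul, ← pow_two]
  exact Ideal.Quotient.eq_zero_iff_mem.mpr (Ideal.subset_span (by simp))

theorem v_mul_v : v F * v F = 0 := by
  rw [v, ← map_mul, ← pow_two]
  exact Ideal.Quotient.eq_zero_iff_mem.mpr (Ideal.subset_span (by simp))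

theorem u_mul_v_ne_zero : u F * v F ≠ 0 := by
  let φ : MvPolynomial (Fin 2) F →ₐ[F] DualNumber (DualNumber F) :=
    MvPolynomial.aeval
      (![TrivSqZeroExt.inl DualNumber.eps, DualNumber.eps] : Fin 2 → DualNumber (DualNumber F))
  have hφ : ∀ a ∈ (Ideal.span {MvPolynomial.X 0 ^ 2, MvPolynomial.X 1 ^ 2,
      MvPolynomial.X 0 * MvPolynomial.X 1 - MvPolynomial.X 1 * MvPolynomial.X 0} :
        Ideal (MvPolynomial (Fin 2) F)), φ a = 0 := by
    intro a ha
    refine (Ideal.span_le (I := RingHom.ker φ)).mpr ?_ ha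
    rintro _ (rfl | rfl | rfl)
    · simp [φ, pow_two, ← TrivSqZeroExt.inl_mul]
    · simp [φ, pow_two]
    · simp [mul_comm]
  intro h
  rw [u, v, ← map_mul, Ideal.Quotient.eq_zero_iff_mem] at h
  have h1 := congrArg (fun x => (TrivSqZeroExt.snd (TrivSqZeroExt.snd x))) (hφ _ h)
  simp [φ] at h1

theorem exists_eq_add (r : BaseRing F) : ∃ a b c d : F,
    r = algebraMap F _ a + algebraMap F _ b * u F + algebraMap F _ c * v F
      + algebraMap F _ d * (u F * v F) := by
  obtain ⟨f, rfl⟩ := Ideal.Quotient.mk_surjective r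
  induction f using MvPolynomial.induction_on with
  | C a => exact ⟨a, 0, 0, 0, by simp; rfl⟩
  | add f g hf hg =>
    obtain ⟨a, b, c, d, h⟩ := hf
    obtain ⟨a', b', c', d', h'⟩ := hg
    refine ⟨a + a', b + b', c + c', d + d', ?_⟩
    rw [map_add, h, h']
    simp only [map_add]
    ring
  | mul_X f i hf =>
    obtain ⟨a, b, c, d, h⟩ := hf
    rw [map_mul, h]
    fin_cases i
    · refine ⟨0, a, 0, c, ?_⟩
      change _ * u F = _
      simp only [map_zero]
      linear_combination (algebraMap F (BaseRing F) b + algebraMap F (BaseRing F) d * v F) *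
        u_mul_u (F := F)
    · refine ⟨0, 0, a, b, ?_⟩
      change _ * v F = _
      simp only [map_zero]
      linear_combination (algebraMap F (BaseRing F) c + algebraMap F (BaseRing F) d * u F) *
        v_mul_v (F := F)

theorem algebraMap_mul_uv_ne_zero {a : F} (ha : a ≠ 0) :
    algebraMap F (BaseRing F) a * (u F * v F) ≠ 0 := by
  intro h
  apply u_mul_v_ne_zero (F := F)
  rw [← one_mul (u F * v F), ← map_one (algebraMap F (BaseRing F)), ← inv_mul_cancel₀ ha, map_mul,
    mul_assoc, h, mul_zero]

/-- Every nonzero word has a nonzero multiple with letters in the socle `F u v`. -/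
theorem exists_mul_eq_algebraMap_mul_uv {ι : Type*} {c : ι → BaseRing F} (hc : c ≠ 0) :
    ∃ (r : BaseRing F) (f : ι → F), f ≠ 0 ∧
      ∀ i, r * c i = algebraMap F (BaseRing F) (f i) * (u F * v F) := by
  choose a b k d h using fun i => exists_eq_add (c i)
  have hu := u_mul_u (F := F)
  have hv := v_mul_v (F := F)
  by_cases ha : a = 0
  · by_cases hk : k = 0
    · by_cases hb : b = 0
      · refine ⟨1, d, ?_, fun i => by simp [h, ha, hk, hb]⟩
        rintro hd
        exact hc (funext fun i => by simp [h, ha, hk, hb, hd])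
      · refine ⟨v F, b, hb, fun i => ?_⟩
        rw [h, ha, hk]
        simp only [Pi.zero_apply, map_zero]
        linear_combination (algebraMap F (BaseRing F) (d i) * u F) * hv
    · refine ⟨u F, k, hk, fun i => ?_⟩
      rw [h, ha]
      simp only [Pi.zero_apply, map_zero]
      linear_combination (algebraMap F (BaseRing F) (d i) * v F +
        algebraMap F (BaseRing F) (b i)) * hu
  · refine ⟨u F * v F, a, ha, fun i => ?_⟩
    rw [h]
    linear_combination (algebraMap F (BaseRing F) (d i) * v F ^ 2 +
        algebraMap F (BaseRing F) (b i) * v F) * hu + (algebraMap F (BaseRing F) (k i) * u F) * hv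

theorem isSquare_alpha {b a₃ a₄ : F} (h2 : (2 : F) ≠ 0) (hb : b ≠ 0) :
    IsSquare (alpha (b * b) a₃ a₄) := by
  obtain ⟨c, rfl⟩ : ∃ c, a₃ = 2 * b * c := ⟨a₃ / (2 * b), by field_simp⟩
  obtain ⟨d, rfl⟩ : ∃ d, a₄ = 2 * b * d := ⟨a₄ / (2 * b), by field_simp⟩
  refine ⟨algebraMap F _ b + algebraMap F _ c * v F + algebraMap F _ d * (u F * v F), ?_⟩
  rw [alpha]
  simp only [map_mul, map_ofNat]
  set B := algebraMap F (BaseRing F) b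
  set K := algebraMap F (BaseRing F) c
  set D := algebraMap F (BaseRing F) d
  linear_combination (-K ^ 2 - D ^ 2 * u F ^ 2 - 2 * K * D * u F) * v_mul_v (F := F)

end BaseRingLemmas

section Consta

variable {F : Type*} [Field F]

/-- The reduction `F[x] → 𝓡[x] / ⟨xⁿ - α⟩`. -/
noncomputable def ofFieldPoly (n : ℕ) (α : BaseRing F) : F[X] →+* ConstaRing n α :=
  (AdjoinRoot.mk (X ^ n - C α)).comp (mapRingHom (algebraMap F (BaseRing F)))

theorem wElt_eq (n : ℕ) (α : BaseRing F) (a₀ : F) :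
    wElt n α a₀ = ofFieldPoly n α (X ^ 2 - C a₀) := by
  simp [wElt, ofFieldPoly]

theorem wordPoly_mul_left {A : Type*} [CommRing A] (n : ℕ) (α r : A) (c : Fin n → A) :
    wordPoly n α (fun i => r * c i) = AdjoinRoot.of _ r * wordPoly n α c := by
  rw [wordPoly, wordPoly, ← AdjoinRoot.mk_C, ← map_mul, Finset.mul_sum]
  simp only [C_mul, mul_assoc]

theorem wordPoly_sub {A : Type*} [CommRing A] (n : ℕ) (α : A) (c d : Fin n → A) :
    wordPoly n α (c - d) = wordPoly n α c - wordPoly n α d := by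
  rw [wordPoly, wordPoly, wordPoly, ← map_sub, ← Finset.sum_sub_distrib]
  simp only [Pi.sub_apply, C_sub, sub_mul]

theorem wordPoly_algebraMap_mul (n : ℕ) (α κ : BaseRing F) (f : Fin n → F) :
    wordPoly n α (fun i => algebraMap F _ (f i) * κ) =
      AdjoinRoot.of _ κ * ofFieldPoly n α (∑ i : Fin n, C (f i) * X ^ (i : ℕ)) := by
  simp only [mul_comm _ κ]
  rw [wordPoly_mul_left]
  simp [wordPoly, ofFieldPoly]

theorem wElt_pow_char_pow {p : ℕ} [Fact p.Prime] [CharP F p] (s : ℕ) {a₀ a₁ a₃ a₄ : F}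
    (ha₀ : a₀ ^ p ^ s = a₁) :
    wElt (2 * p ^ s) (alpha a₁ a₃ a₄) a₀ ^ p ^ s =
      AdjoinRoot.of _ (v F * (algebraMap F _ a₃ + algebraMap F _ a₄ * u F)) := by
  have h0 : AdjoinRoot.mk (X ^ (2 * p ^ s) - C (alpha a₁ a₃ a₄))
      (X ^ (2 * p ^ s) - C (alpha a₁ a₃ a₄)) = 0 := AdjoinRoot.mk_self
  rw [wElt_eq, ← map_pow, sub_pow_char_pow, ← pow_mul, ← C_pow, ha₀]
  rw [map_sub, AdjoinRoot.mk_C, sub_eq_zero] at h0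
  rw [ofFieldPoly, RingHom.comp_apply, map_sub, map_pow, coe_mapRingHom, map_X, map_C, map_sub, h0,
    AdjoinRoot.mk_C, ← map_sub, alpha]
  congr 1
  ring

theorem isNilpotent_wElt {p : ℕ} [Fact p.Prime] [CharP F p] (s : ℕ) {a₀ a₁ a₃ a₄ : F}
    (ha₀ : a₀ ^ p ^ s = a₁) : IsNilpotent (wElt (2 * p ^ s) (alpha a₁ a₃ a₄) a₀) := by
  refine ⟨p ^ s * 2, ?_⟩
  rw [pow_mul, wElt_pow_char_pow s ha₀, ← map_pow, mul_pow, pow_two (v F), v_mul_v, zero_mul,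
    map_zero]

theorem uElt_mul_wElt_pow_char_pow {p : ℕ} [Fact p.Prime] [CharP F p] (s : ℕ) {a₀ a₁ a₃ a₄ : F}
    (ha₀ : a₀ ^ p ^ s = a₁) :
    uElt (2 * p ^ s) (alpha a₁ a₃ a₄) * wElt (2 * p ^ s) (alpha a₁ a₃ a₄) a₀ ^ p ^ s =
      AdjoinRoot.of _ (algebraMap F _ a₃) * AdjoinRoot.of _ (u F * v F) := by
  rw [wElt_pow_char_pow s ha₀, uElt, ← map_mul, ← map_mul]
  congr 1
  linear_combination (v F * algebraMap F _ a₄) * u_mul_u (F := F)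

theorem of_uv_eq {p : ℕ} [Fact p.Prime] [CharP F p] (s : ℕ) {a₀ a₁ a₃ a₄ : F}
    (ha₀ : a₀ ^ p ^ s = a₁) (ha₃ : a₃ ≠ 0) :
    AdjoinRoot.of (X ^ (2 * p ^ s) - C (alpha a₁ a₃ a₄)) (u F * v F) =
      AdjoinRoot.of _ (algebraMap F _ a₃⁻¹) *
        (uElt (2 * p ^ s) (alpha a₁ a₃ a₄) * wElt (2 * p ^ s) (alpha a₁ a₃ a₄) a₀ ^ p ^ s) := by
  rw [uElt_mul_wElt_pow_char_pow s ha₀, ← mul_assoc,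
    ← map_mul (AdjoinRoot.of _) (algebraMap F _ _), ← map_mul (algebraMap F _), inv_mul_cancel₀ ha₃,
    map_one, map_one, one_mul]

theorem mem_span_singleton_of_mem_span_pair {A : Type*} [CommRing A] {g U w : A}
    (hw : IsNilpotent w) {k μ : ℕ} (hk : k < μ)
    (h : U * w ^ k ∈ Ideal.span {g, U * w ^ μ}) : U * w ^ k ∈ Ideal.span {g} := by
  obtain ⟨a, b, hab⟩ := Ideal.mem_span_pair.mp h
  have hunit : IsUnit (1 - b * w ^ (μ - k)) :=
    ((Commute.all b _).isNilpotent_mul_left (hw.pow_of_pos (by omega))).isUnit_one_sub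
  rw [← Ideal.mul_unit_mem_iff_mem _ hunit]
  have hμ : w ^ μ = w ^ k * w ^ (μ - k) := by rw [← pow_add]; congr 1; omega
  rw [hμ] at hab
  exact Ideal.mem_span_singleton'.mpr ⟨a, by linear_combination hab⟩

theorem pow_dvd_of_mem_typeDIdeal {p : ℕ} [Fact p.Prime] [CharP F p] (s : ℕ) {a₀ a₁ a₃ a₄ : F}
    (ha₀ : a₀ ^ p ^ s = a₁) (hirr : Irreducible (X ^ 2 - C a₀)) {l t μ : ℕ}
    {z : ConstaRing (2 * p ^ s) (alpha a₁ a₃ a₄)}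
    (hμ : μ < torsionIndex (2 * p ^ s) (alpha a₁ a₃ a₄) a₀ l t z) {f : F[X]}
    (hf : AdjoinRoot.of _ (u F * v F) * ofFieldPoly (2 * p ^ s) (alpha a₁ a₃ a₄) f ∈
      typeDIdeal (2 * p ^ s) (alpha a₁ a₃ a₄) a₀ l t μ z) {k : ℕ} (hk : p ^ s + k ≤ μ) :
    (X ^ 2 - C a₀) ^ k ∣ f := by
  induction k with
  | zero => simp
  | succ k ih =>
    obtain ⟨g, rfl⟩ := ih (by omega)
    rw [pow_succ]
    refine mul_dvd_mul_left _ ?_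
    by_contra hg
    have hnil := isNilpotent_wElt (a₃ := a₃) (a₄ := a₄) s ha₀
    obtain ⟨N, hN⟩ := hnil
    obtain ⟨x, y, hxy⟩ := ((hirr.coprime_iff_not_dvd.mpr hg).pow_left (m := N))
    have hmem : uElt (2 * p ^ s) (alpha a₁ a₃ a₄) *
        wElt (2 * p ^ s) (alpha a₁ a₃ a₄) a₀ ^ (p ^ s + k) ∈
          typeDIdeal (2 * p ^ s) (alpha a₁ a₃ a₄) a₀ l t μ z := by
      have h1 := congrArg (ofFieldPoly (2 * p ^ s) (alpha a₁ a₃ a₄)) hxy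
      rw [map_add, map_mul, map_mul, map_pow, ← wElt_eq, hN, mul_zero, zero_add, map_one] at h1
      rw [map_mul (ofFieldPoly _ _), map_pow, ← wElt_eq] at hf
      have h2 := uElt_mul_wElt_pow_char_pow (a₃ := a₃) (a₄ := a₄) s ha₀
      convert Ideal.mul_mem_left _ (AdjoinRoot.of _ (algebraMap F _ a₃) *
        ofFieldPoly (2 * p ^ s) (alpha a₁ a₃ a₄) y) hf using 1
      rw [pow_add, ← mul_assoc, h2]
      linear_combination (-(AdjoinRoot.of _ (algebraMap F _ a₃) * AdjoinRoot.of _ (u F * v F) *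
        wElt (2 * p ^ s) (alpha a₁ a₃ a₄) a₀ ^ k)) * h1
    have hlt : p ^ s + k < μ := by omega
    exact Nat.notMem_of_lt_sInf (hlt.trans hμ)
      (mem_span_singleton_of_mem_span_pair ⟨N, hN⟩ hlt hmem)

theorem mem_typeDIdeal_of_le {p : ℕ} [Fact p.Prime] [CharP F p] (s : ℕ) {a₀ a₁ a₃ a₄ : F}
    (ha₀ : a₀ ^ p ^ s = a₁) (ha₃ : a₃ ≠ 0) {l t μ k : ℕ}
    {z : ConstaRing (2 * p ^ s) (alpha a₁ a₃ a₄)} (hk : μ ≤ p ^ s + k) :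
    AdjoinRoot.of _ (u F * v F) *
      ofFieldPoly (2 * p ^ s) (alpha a₁ a₃ a₄) ((X ^ 2 - C a₀) ^ k) ∈
        typeDIdeal (2 * p ^ s) (alpha a₁ a₃ a₄) a₀ l t μ z := by
  rw [of_uv_eq s ha₀ ha₃, map_pow, ← wElt_eq, mul_assoc, mul_assoc, ← pow_add,
    ← Nat.sub_add_cancel hk, pow_add, mul_left_comm (uElt _ _)]
  exact Ideal.mul_mem_left _ _ (Ideal.mul_mem_left _ _ (Ideal.subset_span (by simp)))

end Consta

section Words

variable {F : Type*} [Field F]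

theorem coeff_sum_C_mul_X_pow {n : ℕ} (f : Fin n → F) (k : ℕ) :
    (∑ i : Fin n, C (f i) * X ^ (i : ℕ)).coeff k = if h : k < n then f ⟨k, h⟩ else 0 := by
  simp only [finsetSum_coeff, coeff_C_mul, coeff_X_pow]
  split_ifs with h
  · rw [Finset.sum_eq_single ⟨k, h⟩]
    · simp
    · intro i _ hi
      rw [if_neg (fun hk => hi (Fin.ext hk.symm)), mul_zero]
    · simp
  · refine Finset.sum_eq_zero fun i _ => ?_
    rw [if_neg (by omega), mul_zero]

/-- A polynomial over `F` whose `u v`-multiple lies in the code bounds the pair distance of the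
code from above. -/
theorem exists_pairDist_le {n : ℕ} [NeZero n] {α : BaseRing F} {I : Ideal (ConstaRing n α)}
    {f : F[X]} (hf : f ≠ 0) (hdeg : f.natDegree < n)
    (hI : AdjoinRoot.of _ (u F * v F) * ofFieldPoly n α f ∈ I) :
    ∃ x ∈ codeOf I, ∃ y ∈ codeOf I, x ≠ y ∧ pairDist x y ≤ 2 * f.support.card := by
  classical
  have hsum : f = ∑ i : Fin n, C (f.coeff i) * X ^ (i : ℕ) := by
    rw [Fin.sum_univ_eq_sum_range (fun i => C (f.coeff i) * X ^ i) n]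
    exact as_sum_range_C_mul_X_pow' f hdeg
  refine ⟨fun i => algebraMap F _ (f.coeff i) * (u F * v F), ?_, 0, ?_, ?_, ?_⟩
  · change wordPoly n α _ ∈ I
    rwa [wordPoly_algebraMap_mul, ← hsum]
  · change wordPoly n α 0 ∈ I
    simp [wordPoly]
  · intro h
    refine algebraMap_mul_uv_ne_zero ?_ (congrFun h ⟨f.natDegree, hdeg⟩)
    simpa using hf
  · refine (pairDist_le_two_mul _ _ (Finset.univ.filter fun i : Fin n => f.coeff i ≠ 0) ?_).trans
      (Nat.mul_le_mul_left 2 ?_)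
    · intro i hi
      refine Finset.mem_filter.mpr ⟨Finset.mem_univ _, fun h0 => hi ?_⟩
      simp [h0]
    · refine Finset.card_le_card_of_injOn (fun i => (i : ℕ)) ?_ Fin.val_injective.injOn
      intro i hi
      simpa using hi

/-- Two distinct words of a code whose difference is, up to a scalar, `u v` times a word `f` over
`F`. -/
theorem exists_socle_word {n : ℕ} {α : BaseRing F} {I : Ideal (ConstaRing n α)}
    {x y : Fin n → BaseRing F} (hx : x ∈ codeOf I) (hy : y ∈ codeOf I) (hxy : x ≠ y) :
    ∃ f : Fin n → F, f ≠ 0 ∧ (∀ i, f i ≠ 0 → x i ≠ y i) ∧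
      AdjoinRoot.of _ (u F * v F) * ofFieldPoly n α (∑ i : Fin n, C (f i) * X ^ (i : ℕ)) ∈ I := by
  obtain ⟨r, f, hf, h⟩ := exists_mul_eq_algebraMap_mul_uv (sub_ne_zero.mpr hxy)
  refine ⟨f, hf, fun i hi he => algebraMap_mul_uv_ne_zero hi ?_, ?_⟩
  · rw [← h, Pi.sub_apply, he, sub_self, mul_zero]
  · rw [← wordPoly_algebraMap_mul]
    simp only [← h]
    rw [wordPoly_mul_left, wordPoly_sub]
    exact Ideal.mul_mem_left _ _ (Ideal.sub_mem _ hx hy)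

/-- The lower bound for the pair distance of two words whose difference is supported on a
multiple of a power of `X ^ 2 - a`. -/
theorem mul_pow_le_pairDist {A : Type*} {p : ℕ} [Fact p.Prime] [CharP F p] {a : F} (ha : a ≠ 0)
    (e k g : ℕ) {N : ℕ} [NeZero (2 * N)] (hN : N = p ^ (e + g + 1)) {f : Fin (2 * N) → F}
    (hf : f ≠ 0)
    (hd : (X ^ 2 - C a) ^ (p ^ (e + g + 1) - p ^ (e + 1) + p ^ e * k + 1) ∣
      ∑ i : Fin (2 * N), C (f i) * X ^ (i : ℕ))
    {x y : Fin (2 * N) → A} (hxy : ∀ i, f i ≠ 0 → x i ≠ y i) :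
    2 * ((k + 2) * p ^ g) ≤ pairDist x y := by
  classical
  set P : F[X] := ∑ i : Fin (2 * N), C (f i) * X ^ (i : ℕ) with hP
  have hcoef := coeff_sum_C_mul_X_pow f
  rw [← hP] at hcoef
  have hP0 : P ≠ 0 := by
    intro h0
    refine hf (funext fun i => ?_)
    have := hcoef i
    rw [h0, coeff_zero, dif_pos i.2] at this
    exact this.symm
  obtain ⟨ε, hε, hA⟩ := exists_polySection_ne_zero two_pos hP0
  have hAd : (X - C a) ^ (p ^ (e + g + 1) - p ^ (e + 1) + p ^ e * k + 1) ∣ polySection 2 ε P := by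
    obtain ⟨c, hc⟩ := hd
    have h2 : (X ^ 2 - C a : F[X]) = expand F 2 (X - C a) := by simp
    rw [hc, h2, ← map_pow, polySection_expand_mul hε]
    exact dvd_mul_right _ _
  have hAdeg : (polySection 2 ε P).degree < ((p ^ (e + g + 1) : ℕ) : WithBot ℕ) := by
    refine degree_polySection_lt two_ne_zero ?_
    rw [degree_lt_iff_coeff_zero]
    intro m hm
    rw [hcoef, dif_neg (by omega)]
  refine (Nat.mul_le_mul_left 2 (mul_pow_le_card_support ha e k g _ hA hAdeg hAd)).trans ?_
  refine le_trans (Nat.mul_le_mul_left 2 ?_) (two_mul_le_pairDist x y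
    (Finset.univ.filter fun i : Fin (2 * N) => (i : ℕ) % 2 = ε ∧ f i ≠ 0) ε
    (fun i hi => (Finset.mem_filter.mp hi).2.1)
    (fun i hi => hxy i (Finset.mem_filter.mp hi).2.2))
  refine (Finset.card_le_card (?_ : _ ⊆ Finset.image (fun i : Fin (2 * N) => (i : ℕ) / 2) _)).trans
    Finset.card_image_le
  intro m hm
  rw [mem_support_iff, coeff_polySection two_ne_zero, hcoef] at hm
  split_ifs at hm with hlt
  · refine Finset.mem_image.mpr ⟨⟨m * 2 + ε, hlt⟩, Finset.mem_filter.mpr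
      ⟨Finset.mem_univ _, ?_, hm⟩, ?_⟩
    · change (m * 2 + ε) % 2 = ε
      omega
    · change (m * 2 + ε) / 2 = m
      omega
  · exact absurd rfl hm

theorem alphaZero_pow [Finite F] {p m s : ℕ} (hm : 0 < m) (hF : Nat.card F = p ^ m) (a : F) :
    alphaZero p m s a ^ p ^ s = a := by
  have := Fintype.ofFinite F
  have hs : s ≤ (s / m + 1) * m := by
    have h1 := Nat.div_add_mod' s m
    have h2 := Nat.mod_lt s hm
    rw [add_mul]
    omega
  rw [alphaZero, ← pow_mul, ← pow_add, Nat.sub_add_cancel hs, mul_comm, pow_mul, ← hF,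
    Nat.card_eq_fintype_card, FiniteField.pow_card_pow]

theorem two_le_pairDist {A : Type*} {N : ℕ} [NeZero (2 * N)] {x y : Fin (2 * N) → A}
    (hxy : x ≠ y) : 2 ≤ pairDist x y := by
  obtain ⟨i, hi⟩ := Function.ne_iff.mp hxy
  simpa using two_mul_le_pairDist x y {i} (i % 2) (by simp) (by simpa using hi)

end Words

end PairCode

theorem theorem17 {F : Type*} [Field F] [Finite F] (p m s : ℕ) [Fact p.Prime] (hp : p ≠ 2)
    (hm : 0 < m) (hs : 0 < s) (hF : Nat.card F = p ^ m)
    (a₁ a₃ a₄ : F) (ha₁ : a₁ ≠ 0) (ha₃ : a₃ ≠ 0)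
    (hα : ¬ IsSquare (PairCode.alpha a₁ a₃ a₄))
    (l t μ : ℕ) (hl : l ≤ 2 * p ^ s - 1) (ht : t < l)
    (z : PairCode.ConstaRing (2 * p ^ s) (PairCode.alpha a₁ a₃ a₄)) (hz : z = 0 ∨ IsUnit z)
    (hμ : μ < PairCode.torsionIndex (2 * p ^ s) (PairCode.alpha a₁ a₃ a₄)
      (PairCode.alphaZero p m s a₁) l t z) :
    (μ ≤ p ^ s →
      PairCode.codePairDist (PairCode.codeOf
        (PairCode.typeDIdeal (2 * p ^ s) (PairCode.alpha a₁ a₃ a₄)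
          (PairCode.alphaZero p m s a₁) l t μ z)) = 2) ∧
    (∀ Γ γ : ℕ, 1 ≤ Γ → Γ ≤ p - 1 → γ ≤ s - 1 →
      2 * p ^ s - p ^ (s - γ) + (Γ - 1) * p ^ (s - γ - 1) + 1 ≤ μ →
      μ ≤ 2 * p ^ s - p ^ (s - γ) + Γ * p ^ (s - γ - 1) →
      PairCode.codePairDist (PairCode.codeOf
        (PairCode.typeDIdeal (2 * p ^ s) (PairCode.alpha a₁ a₃ a₄)
          (PairCode.alphaZero p m s a₁) l t μ z)) = 2 * (Γ + 1) * p ^ γ) := by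
  have hpp : p.Prime := Fact.out
  have hpF : (p : F) = 0 := by
    have h : ((p ^ m : ℕ) : F) = 0 := by
      have := Fintype.ofFinite F
      rw [← hF, Nat.card_eq_fintype_card]
      exact Nat.cast_card_eq_zero F
    rw [Nat.cast_pow] at h
    exact eq_zero_of_pow_eq_zero h
  have : CharP F p := (CharP.charP_iff_prime_eq_zero hpp).mpr hpF
  have h2 : (2 : F) ≠ 0 := by
    intro h
    have h' : ((2 : ℕ) : F) = 0 := by exact_mod_cast h
    exact hp ((Nat.prime_dvd_prime_iff_eq hpp Nat.prime_two).mp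
      ((CharP.cast_eq_zero_iff F p 2).mp h'))
  have ha := PairCode.alphaZero_pow (s := s) hm hF a₁
  have ha₀ : PairCode.alphaZero p m s a₁ ≠ 0 := pow_ne_zero _ ha₁
  generalize PairCode.alphaZero p m s a₁ = a₀ at ha ha₀ hμ ⊢
  have hirr : Irreducible (X ^ 2 - C a₀) := by
    refine X_pow_sub_C_irreducible_of_prime Nat.prime_two fun b hb => hα ?_
    have hb1 : a₁ = b ^ p ^ s * b ^ p ^ s := by
      rw [← ha, ← hb, ← mul_pow, pow_two]
    rw [hb1]
    refine PairCode.isSquare_alpha h2 fun h => ha₁ ?_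
    rw [hb1, h, mul_zero]
  have hps : 0 < p ^ s := pow_pos hpp.pos s
  refine ⟨fun hle => PairCode.codePairDist_eq ?_ fun x _ y _ hxy => PairCode.two_le_pairDist hxy,
    fun Γ γ hΓ hΓp hγ hμ₁ hμ₂ => PairCode.codePairDist_eq ?_ fun x hx y hy hxy => ?_⟩
  · have hmem := PairCode.mem_typeDIdeal_of_le (k := 0) (l := l) (t := t) (μ := μ) (z := z)
      s ha ha₃ hle
    rw [pow_zero] at hmem
    have h := PairCode.exists_pairDist_le one_ne_zero (by rw [natDegree_one]; omega) hmem
    rwa [← C_1, support_C one_ne_zero, Finset.card_singleton, mul_one] at h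
  all_goals
    obtain ⟨e, rfl⟩ : ∃ e, s = e + γ + 1 := ⟨s - γ - 1, by omega⟩
    obtain ⟨k, rfl⟩ : ∃ k, Γ = k + 1 := ⟨Γ - 1, by omega⟩
    rw [show e + γ + 1 - γ = e + 1 by omega, show e + 1 - 1 = e by omega] at hμ₁ hμ₂
    rw [Nat.add_sub_cancel] at hμ₁
    have hle : p ^ (e + 1) ≤ p ^ (e + γ + 1) := Nat.pow_le_pow_right hpp.pos (by omega)
  · set j := p ^ (e + γ + 1) - p ^ (e + 1) + p ^ e * (k + 1) with hj
    have hjlt : j < p ^ (e + γ + 1) := by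
      have : p ^ e * (k + 1) < p ^ (e + 1) := by
        rw [pow_succ]
        exact Nat.mul_lt_mul_of_pos_left (by omega) (pow_pos hpp.pos e)
      omega
    obtain ⟨x, hx, y, hy, hxy, h⟩ := PairCode.exists_pairDist_le (f := (X ^ 2 - C a₀) ^ j)
      (pow_ne_zero _ hirr.ne_zero) (by rw [natDegree_pow, natDegree_X_pow_sub_C]; omega)
      (PairCode.mem_typeDIdeal_of_le (k := j) (l := l) (t := t) (μ := μ) (z := z) _ ha ha₃
        (by rw [mul_comm (k + 1)] at hμ₂; omega))
    refine ⟨x, hx, y, hy, hxy, h.trans ?_⟩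
    rw [mul_assoc]
    refine Nat.mul_le_mul_left 2 ?_
    have hexp : (X ^ 2 - C a₀ : F[X]) ^ j = expand F 2 ((X - C a₀) ^ j) := by simp
    rw [hexp]
    exact (PairCode.card_support_expand_le _ _).trans
      (PairCode.card_support_X_sub_C_pow_le_mul a₀ e (k + 1) γ)
  · obtain ⟨f, hf, hfxy, hmem⟩ := PairCode.exists_socle_word hx hy hxy
    rw [mul_assoc]
    refine PairCode.mul_pow_le_pairDist ha₀ e k γ rfl hf ?_ hfxy
    exact PairCode.pow_dvd_of_mem_typeDIdeal _ ha hirr hμ hmem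
      (by rw [mul_comm k] at hμ₁; omega)
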